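/- **Setting.** Let $B\subset\mathbb{R}^2$ be a bounded, connected open set with $C^\infty$ boundary containing the origin, with arc length $\sigma$ and outward unit normal $\nu$ on $\partial B$. Let $\langle\cdot,\cdot\rangle_{-1/2,1/2}$ be the duality pairing of $H^{-1/2}(\partial B)$ and $H^{1/2}(\partial B)$ extending the inner product of $L^2(\partial B)$ (linear in the first and conjugate linear in the second argument), and let $\chi$ be the constant function $1$ on $\partial B$. With $\Gamma(x,y)=\frac1{2\pi}\log|x-y|$, the following operators are the bounded extensions to $H^{-1/2}(\partial B)$ of the integral operators $$\mathcal S_B[\phi](x)=\int_{\partial B}\Gamma(x,y)\phi(y)\,d\sigma(y),\qquad \mathcal K_B^*[\phi](x)=\int_{\partial B}\frac{\partial\Gamma(x,y)}{\partial\nu(x)}\phi(y)\,d\sigma(y),$$ $$\mathcal S^{(1)}_{B,1}[\phi](x)=-\frac1{8\pi}\int_{\partial B}|x-y|^2\phi(y)\,d\sigma(y),\qquad \mathcal K^{(1)}_{B,1}[\phi](x)=-\frac1{8\pi}\int_{\partial B}\frac{\partial|x-y|^2}{\partial\nu(x)}\phi(y)\,d\sigma(y),$$ where $\mathcal S_B,\mathcal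 S_{B,1}^{(1)}$ take values in $H^{1/2}(\partial B)$ and $\mathcal K_B^*,\mathcal K_{B,1}^{(1)}$ in $H^{-1/2}(\partial B)$. Let $\phi_0$ be the unique solution of $\mathcal K_B^*\phi_0=\frac12\phi_0$, $\langle\phi_0,\chi\rangle_{-1/2,1/2}=1$. Let $\widetilde{\mathcal S}_B:H^{-1/2}(\partial B)\to H^{1/2}(\partial B)$ be the linear operator that equals $\mathcal S_B$ on $\mathcal H_0^*=\{u:\langle u,\chi\rangle_{-1/2,1/2}=0\}$ and maps $\phi_0$ to $-\chi$. Let $\mathcal H^*$ be $H^{-1/2}(\partial B)$ with the inner product $\langle u,v\rangle_{\mathcal H^*}=-\langle u,\widetilde{\mathcal S}_B v\rangle_{-1/2,1/2}$, and let $\mathcal P$ be the orthogonal projection of $\mathcal H^*$ onto $\mathcal H_0^*$. Let $(\phi_j)_{j\ge0}$ be an orthonormal basis of $\mathcal H^*$ of eigenfunctions, $\mathcal K_B^*\phi_j=\lambda_j\phi_j$ with $\lambda_j\in\mathbb{R}$, starting with the above $\phi_0$ (so $\lambda_0=\frac12$). Let $\varepsilon_0,\mu_0,\omega_p,\mathrm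 T,\delta>0$. A particle of shape $B$ and size $\delta$ has the Drude permittivity $\varepsilon_c(\Omega)=\varepsilon_0\left(1-\frac{\omega_p^2}{\Omega^2+i\Omega \mathrm T^{-1}}\right)$ and lies in a medium with permittivity $\varepsilon_m$, permeability $\mu_m$ and speed of light $c=(\varepsilon_m\mu_m)^{-1/2}$. Put $$\lambda(\Omega)=\frac{\varepsilon_m+\varepsilon_c(\Omega)}{2(\varepsilon_m-\varepsilon_c(\Omega))},\qquad \tau_j(\Omega)=\Big(\frac1{\varepsilon_c(\Omega)}-\frac1{\varepsilon_m}\Big)(\lambda(\Omega)-\lambda_j),\qquad \tau_{j,1}(\Omega)=\langle\mathcal A_{B,1}\phi_j,\phi_j\rangle_{\mathcal H^*},$$ $$\mathcal A_{B,1}=\frac1{\varepsilon_m}\mathcal K^{(1)}_{B,1}(I-\mathcal P)+\Big(\frac12I-\mathcal K_B^*\Big)\widetilde{\mathcal S}_B^{-1}\mathcal S^{(1)}_{B,1}\Big(\frac1{\varepsilon_c(\Omega)}I-\frac1{\varepsilon_m}\mathcal P\Big),$$ $$\alpha_j=\Big\langle\Big(\frac12I-\mathcal K_B^*\Big)\widetilde{\mathcal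 S}_B^{-1}\mathcal S^{(1)}_{B,1}\phi_j,\phi_j\Big\rangle_{\mathcal H^*}.$$ A complex frequency $\Omega$ is admissible if $\Omega^2+i\Omega\mathrm T^{-1}\ne0$ and $\varepsilon_c(\Omega)\neq0$, i.e. if $\varepsilon_c(\Omega)$ and $1/\varepsilon_c(\Omega)$ are defined. It is a (two-dimensional) first-order corrected plasmonic resonance of the mode $j\geq 1$ if it is admissible and $$\left|\tau_j(\Omega)+(\Omega\delta c^{-1})^2\log(\Omega\delta c^{-1})\,\tau_{j,1}(\Omega)\right|=0,$$ where $\log$ is the principal branch of the complex logarithm. **Proposition.** Suppose that the medium is vacuum, $\varepsilon_m=\varepsilon_0$ and $\mu_m=\mu_0$. Then, for every $j\ge1$, the first-order corrected plasmonic resonances of the mode $j$ are exactly the admissible roots $\Omega\in\mathbb{C}$ of $$\frac{\Omega^2+i\Omega\,\mathrm T^{-1}}{\omega_p^2}-\frac12-\lambda_j+(\Omega\delta c^{-1})^2\log(\Omega\delta c^{-1})\,\alpha_j=0 .$$ -/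

import Mathlib

open MeasureTheory Filter Topology
open scoped ContDiff

namespace Plasmon

/-- The plane `ℝ²`, with its Euclidean norm. -/
abbrev Plane : Type := EuclideanSpace ℝ (Fin 2)

/-- `ρ` is a smooth defining function of the set `B` near the point `x`. -/
def IsLocalDefiningFunction (B : Set Plane) (x : Plane) (ρ : Plane → ℝ) : Prop :=
  ContDiff ℝ ∞ ρ ∧ gradient ρ x ≠ 0 ∧ ∀ᶠ y in 𝓝 x, (y ∈ B ↔ ρ y < 0)

/-- A reference domain: a bounded domain of class `C^∞` in the plane which contains the origin. -/
structure SmoothDomain where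
  carrier : Set Plane
  isOpen : IsOpen carrier
  isConnected : IsConnected carrier
  isBounded : Bornology.IsBounded carrier
  zero_mem : (0 : Plane) ∈ carrier
  smooth : ∀ x ∈ frontier carrier, ∃ ρ : Plane → ℝ, IsLocalDefiningFunction carrier x ρ

/-- The arc length measure `σ` on the boundary `∂B`. -/
noncomputable def bdry (B : SmoothDomain) : Measure Plane :=
  (Measure.hausdorffMeasure 1).restrict (frontier B.carrier)

theorem defining_eq_zero {B : Set Plane} (hB : IsOpen B) {y : Plane} {ρ : Plane → ℝ}
    (hρ : Continuous ρ) (h : ∀ᶠ w in 𝓝 y, (w ∈ B ↔ ρ w < 0)) (hy : y ∈ frontier B) :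
    ρ y = 0 := by
  have hyB : y ∉ B := by
    rw [hB.frontier_eq] at hy
    exact hy.2
  have h1 : ¬ ρ y < 0 := fun h2 => hyB (h.self_of_nhds.2 h2)
  by_contra hne
  have hpos : 0 < ρ y := lt_of_le_of_ne (not_lt.1 h1) (Ne.symm hne)
  have hev : ∀ᶠ w in 𝓝 y, 0 < ρ w := hρ.continuousAt.eventually (lt_mem_nhds hpos)
  have hcl : y ∈ closure B := hy.1
  obtain ⟨w, hw, hw2⟩ := (mem_closure_iff_frequently.1 hcl).and_eventually (hev.and h) |>.exists
  exact absurd (hw2.2.1 hw) (not_lt.2 hw2.1.le)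

theorem bdry_finiteAt (B : SmoothDomain) {x : Plane} (hx : x ∈ frontier B.carrier) :
    (Measure.hausdorffMeasure 1 : Measure Plane).FiniteAtFilter (𝓝[frontier B.carrier] x) := by
  obtain ⟨ρ, hρ, hg, hev⟩ := B.smooth x hx
  set g : Plane := gradient ρ x with hgdef
  have hstrict : HasStrictFDerivAt ρ (fderiv ℝ ρ x) x :=
    hρ.contDiffAt.hasStrictFDerivAt (by simp)
  have hgpos : 0 < ‖g‖ := norm_pos_iff.2 hg
  have hL : ∀ v, fderiv ℝ ρ x v = inner ℝ g v := by
    intro v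
    rw [hgdef, gradient, InnerProductSpace.toDual_symm_apply]
  have hsmall := hstrict.isLittleO.def (half_pos hgpos)
  rw [nhds_prod_eq, eventually_iff_exists_mem] at hsmall
  obtain ⟨W, hW, hWs⟩ := hsmall
  obtain ⟨U, hU, hUW⟩ := mem_prod_self_iff.1 hW
  have hb : Metric.ball x 1 ∈ 𝓝 x := Metric.ball_mem_nhds x one_pos
  set V : Set Plane := U ∩ {y | ∀ᶠ w in 𝓝 y, (w ∈ B.carrier ↔ ρ w < 0)} ∩ Metric.ball x 1 with hV
  have hVn : V ∈ 𝓝 x := inter_mem (inter_mem hU (eventually_eventually_nhds.2 hev)) hb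
  set s : Set Plane := V ∩ frontier B.carrier with hs
  refine ⟨s, inter_mem (mem_nhdsWithin_of_mem_nhds hVn) self_mem_nhdsWithin, ?_⟩
  set t : Plane → ℝ := fun y => g 0 * y 1 - g 1 * y 0 with ht
  have hanti : ∀ y ∈ s, ∀ w ∈ s, ‖y - w‖ ≤ 2 / ‖g‖ * |t y - t w| := by
    intro y hy w hw
    have hy0 : ρ y = 0 := defining_eq_zero B.isOpen hρ.continuous hy.1.1.2 hy.2
    have hw0 : ρ w = 0 := defining_eq_zero B.isOpen hρ.continuous hw.1.1.2 hw.2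
    have h1 := hWs (y, w) (hUW ⟨hy.1.1.1, hw.1.1.1⟩)
    simp only [hy0, hw0, sub_zero, zero_sub, norm_neg, hL] at h1
    have h2 : (inner ℝ g (y - w)) ^ 2 + (t y - t w) ^ 2 = ‖g‖ ^ 2 * ‖y - w‖ ^ 2 := by
      simp only [ht, EuclideanSpace.real_norm_sq_eq, PiLp.inner_apply, Fin.sum_univ_two,
        RCLike.inner_apply, conj_trivial, PiLp.sub_apply]
      ring
    have h3 : (inner ℝ g (y - w)) ^ 2 ≤ (‖g‖ / 2 * ‖y - w‖) ^ 2 := by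
      rw [← sq_abs]
      exact pow_le_pow_left₀ (abs_nonneg _) h1 2
    have h4 : (‖g‖ / 2 * ‖y - w‖) ^ 2 ≤ |t y - t w| ^ 2 := by
      rw [sq_abs]
      nlinarith [sq_nonneg (‖g‖ * ‖y - w‖)]
    have h5 : ‖g‖ / 2 * ‖y - w‖ ≤ |t y - t w| := le_of_sq_le_sq h4 (abs_nonneg _)
    rw [div_mul_eq_mul_div, le_div_iff₀ hgpos]
    linarith
  have hinj : Set.InjOn t s := by
    intro y hy w hw hyw
    have := hanti y hy w hw
    rw [hyw, sub_self, abs_zero, mul_zero] at this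
    exact sub_eq_zero.1 (norm_le_zero_iff.1 this)
  set K : NNReal := ⟨2 / ‖g‖, by positivity⟩ with hK
  have hlip : LipschitzOnWith K (Function.invFunOn t s) (t '' s) := by
    refine LipschitzOnWith.of_dist_le_mul ?_
    rintro _ ⟨y, hy, rfl⟩ _ ⟨w, hw, rfl⟩
    rw [hinj.leftInvOn_invFunOn hy, hinj.leftInvOn_invFunOn hw, dist_eq_norm, Real.dist_eq]
    exact hanti y hy w hw
  have himg : Function.invFunOn t s '' (t '' s) = s := hinj.invFunOn_image subset_rfl
  have hle := hlip.hausdorffMeasure_image_le (d := 1) zero_le_one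
  rw [himg] at hle
  have htc : Continuous t := by
    simp only [ht]
    fun_prop
  have hbdd : Bornology.IsBounded (t '' s) := by
    have hc : IsCompact (t '' Metric.closedBall x 1) :=
      (isCompact_closedBall x 1).image htc
    refine hc.isBounded.subset (Set.image_mono ?_)
    exact fun y hy => Metric.ball_subset_closedBall hy.1.2
  refine lt_of_le_of_lt hle (ENNReal.mul_lt_top (by simp) ?_)
  rw [hausdorffMeasure_real]
  exact hbdd.measure_lt_top

instance bdry_isFiniteMeasure (B : SmoothDomain) : IsFiniteMeasure (bdry B) := by
  refine ⟨?_⟩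
  rw [bdry, Measure.restrict_apply_univ]
  have hc : IsCompact (frontier B.carrier) :=
    B.isBounded.isCompact_closure.of_isClosed_subset isClosed_frontier frontier_subset_closure
  exact hc.measure_lt_top_of_nhdsWithin fun x hx => bdry_finiteAt B hx

/-- The outward unit normal `ν(x)` at a boundary point `x`: the normalised gradient of any local
defining function. -/
noncomputable def normal (B : SmoothDomain) (x : Plane) : Plane :=
  open Classical in
  if h : ∃ ρ : Plane → ℝ, IsLocalDefiningFunction B.carrier x ρ then
    ‖gradient h.choose x‖⁻¹ • gradient h.choose x
  else 0

/-- The normal derivative `∂f/∂ν` at `x`. -/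
noncomputable def normalDeriv (B : SmoothDomain) (f : Plane → ℝ) (x : Plane) : ℝ :=
  fderiv ℝ f x (normal B x)

/-! ### The spaces `H^{1/2}(∂B)` and `H^{-1/2}(∂B)` -/

/-- The space `L²(∂B)` of complex densities. -/
abbrev L2 (B : SmoothDomain) : Type := Lp ℂ 2 (bdry B)

/-- The Sobolev–Slobodeckij space `H^{1/2}(∂B)`: a function `f ∈ L²(∂B)` is recorded with its
difference quotient `(f(x) - f(y)) / |x - y|`, which has to be in `L²(∂B × ∂B)`. The norm is
`‖f‖² = ∫ |f|² + ∫∫ |f(x) - f(y)|² / |x - y|²`. -/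
noncomputable def sobolevHalf (B : SmoothDomain) :
    Submodule ℂ (WithLp 2 (L2 B × Lp ℂ 2 ((bdry B).prod (bdry B)))) where
  carrier := {p | ∀ᵐ z ∂((bdry B).prod (bdry B)),
    p.snd z = (p.fst z.1 - p.fst z.2) / (‖z.1 - z.2‖ : ℂ)}
  zero_mem' := by
    have h := Lp.coeFn_zero ℂ 2 (bdry B)
    have h1 := Measure.quasiMeasurePreserving_fst (μ := bdry B) (ν := bdry B) |>.ae h
    have h2 := Measure.quasiMeasurePreserving_snd (μ := bdry B) (ν := bdry B) |>.ae h
    filter_upwards [h1, h2, Lp.coeFn_zero ℂ 2 ((bdry B).prod (bdry B))] with z h1 h2 h3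
    simp_all
  add_mem' := by
    intro p q hp hq
    have h := Lp.coeFn_add p.fst q.fst
    have h1 := Measure.quasiMeasurePreserving_fst (μ := bdry B) (ν := bdry B) |>.ae h
    have h2 := Measure.quasiMeasurePreserving_snd (μ := bdry B) (ν := bdry B) |>.ae h
    change ∀ᵐ z ∂((bdry B).prod (bdry B)),
      (p + q).snd z = ((p + q).fst z.1 - (p + q).fst z.2) / (‖z.1 - z.2‖ : ℂ)
    filter_upwards [h1, h2, Lp.coeFn_add p.snd q.snd, hp, hq] with z h1 h2 h3 h4 h5
    rw [WithLp.add_fst, WithLp.add_snd, h1, h2, h3, Pi.add_apply, Pi.add_apply, Pi.add_apply,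
      h4, h5]
    ring
  smul_mem' := by
    intro a p hp
    have h := Lp.coeFn_smul a p.fst
    have h1 := Measure.quasiMeasurePreserving_fst (μ := bdry B) (ν := bdry B) |>.ae h
    have h2 := Measure.quasiMeasurePreserving_snd (μ := bdry B) (ν := bdry B) |>.ae h
    change ∀ᵐ z ∂((bdry B).prod (bdry B)),
      (a • p).snd z = ((a • p).fst z.1 - (a • p).fst z.2) / (‖z.1 - z.2‖ : ℂ)
    filter_upwards [h1, h2, Lp.coeFn_smul a p.snd, hp] with z h1 h2 h3 h4
    rw [WithLp.smul_fst, WithLp.smul_snd, h1, h2, h3, Pi.smul_apply, Pi.smul_apply, Pi.smul_apply,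
      h4, smul_eq_mul, smul_eq_mul, smul_eq_mul]
    ring

/-- `H^{1/2}(∂B)`. -/
abbrev HPlus (B : SmoothDomain) : Type := sobolevHalf B

/-- The inclusion of `H^{1/2}(∂B)` into `L²(∂B)`. -/
noncomputable def toL2 (B : SmoothDomain) : HPlus B →L[ℂ] L2 B :=
  (WithLp.fstL 2 ℂ (L2 B) (Lp ℂ 2 ((bdry B).prod (bdry B)))).comp (sobolevHalf B).subtypeL

/-- `H^{-1/2}(∂B)`, the (anti-)dual space of `H^{1/2}(∂B)`: the duality pairing
`⟨u, f⟩_{-1/2,1/2} = u f` is linear in `u`, conjugate linear in `f`, and extends the `L²` inner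
product `∫ u \bar f dσ`. -/
abbrev HMinus (B : SmoothDomain) : Type := HPlus B →L⋆[ℂ] ℂ

/-- The inclusion of `L²(∂B)` into `H^{-1/2}(∂B)`: `⟨φ, f⟩ = ∫ φ \bar f dσ`. -/
noncomputable def ofL2 (B : SmoothDomain) (φ : L2 B) : HMinus B :=
  (innerSLFlip ℂ φ).comp (toL2 B)

/-- The constant function `χ(∂B) = 1` as an element of `H^{1/2}(∂B)`. -/
noncomputable def one (B : SmoothDomain) : HPlus B :=
  ⟨WithLp.toLp 2 (MemLp.toLp (fun _ => (1 : ℂ)) (memLp_const 1), 0), by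
    have h := MemLp.coeFn_toLp (memLp_const (1 : ℂ) : MemLp (fun _ : Plane => (1 : ℂ)) 2 (bdry B))
    have h1 := Measure.quasiMeasurePreserving_fst (μ := bdry B) (ν := bdry B) |>.ae h
    have h2 := Measure.quasiMeasurePreserving_snd (μ := bdry B) (ν := bdry B) |>.ae h
    filter_upwards [h1, h2, Lp.coeFn_zero ℂ 2 ((bdry B).prod (bdry B))] with z h1 h2 h3
    change (0 : Lp ℂ 2 ((bdry B).prod (bdry B))) z =
      ((MemLp.toLp (fun _ => (1 : ℂ)) (memLp_const 1) : L2 B) z.1 -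
        (MemLp.toLp (fun _ => (1 : ℂ)) (memLp_const 1) : L2 B) z.2) / (‖z.1 - z.2‖ : ℂ)
    rw [h3, h1, h2]
    simp⟩

/-- `u ↦ ⟨u, χ(∂B)⟩_{-1/2,1/2}`. -/
noncomputable def mean (B : SmoothDomain) : HMinus B →L[ℂ] ℂ :=
  ContinuousLinearMap.apply' ℂ (starRingEnd ℂ) (one B)

/-! ### Layer potentials -/

/-- The integral operator on `∂B` with kernel `k`. -/
noncomputable def integralOp (B : SmoothDomain) (k : Plane → Plane → ℝ) (φ : Plane → ℂ) :
    Plane → ℂ :=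
  fun x => ∫ y, (k x y : ℂ) * φ y ∂(bdry B)

/-- The bounded operator `H^{-1/2}(∂B) → H^{1/2}(∂B)` which is given by the kernel `k` on `L²(∂B)`
(unique, as `L²(∂B)` is dense in `H^{-1/2}(∂B)`). -/
noncomputable def smoothingOp (B : SmoothDomain) (k : Plane → Plane → ℝ) :
    HMinus B →L[ℂ] HPlus B :=
  open Classical in
  if h : ∃ A : HMinus B →L[ℂ] HPlus B,
      ∀ φ : L2 B, toL2 B (A (ofL2 B φ)) =ᵐ[bdry B] integralOp B k φ then h.choose
  else 0

/-- The bounded operator on `H^{-1/2}(∂B)` which is given by the kernel `k` on `L²(∂B)`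
(unique, as `L²(∂B)` is dense in `H^{-1/2}(∂B)`). -/
noncomputable def boundaryOp (B : SmoothDomain) (k : Plane → Plane → ℝ) :
    HMinus B →L[ℂ] HMinus B :=
  open Classical in
  if h : ∃ A : HMinus B →L[ℂ] HMinus B,
      ∀ φ : L2 B, ∃ ψ : L2 B, ψ =ᵐ[bdry B] integralOp B k φ ∧ A (ofL2 B φ) = ofL2 B ψ then h.choose
  else 0

/-- The fundamental solution `Γ(x, y) = (2π)⁻¹ log |x - y|` of the Laplacian in the plane. -/
noncomputable def Gamma (x y : Plane) : ℝ := 1 / (2 * Real.pi) * Real.log ‖x - y‖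

/-- The single-layer potential `S_B`, with kernel `Γ(x, y)`. -/
noncomputable def S (B : SmoothDomain) : HMinus B →L[ℂ] HPlus B := smoothingOp B Gamma

/-- The Neumann–Poincaré operator `K_B^*`, with kernel `∂Γ(x, y)/∂ν(x)`. -/
noncomputable def Kstar (B : SmoothDomain) : HMinus B →L[ℂ] HMinus B :=
  boundaryOp B fun x y => normalDeriv B (fun x' => Gamma x' y) x

/-- The operator `S_{B,1}^{(1)}`, with kernel `-|x - y|² / (8π)`. -/
noncomputable def S11 (B : SmoothDomain) : HMinus B →L[ℂ] HPlus B :=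
  smoothingOp B fun x y => -1 / (8 * Real.pi) * ‖x - y‖ ^ 2

/-- The operator `K_{B,1}^{(1)}`, with kernel `-(8π)⁻¹ ∂|x - y|²/∂ν(x)`. -/
noncomputable def K11 (B : SmoothDomain) : HMinus B →L[ℂ] HMinus B :=
  boundaryOp B fun x y => -1 / (8 * Real.pi) * normalDeriv B (fun x' => ‖x' - y‖ ^ 2) x

/-- The eigenfunction `φ₀` of `K_B^*` for the eigenvalue `1/2` with `⟨φ₀, χ(∂B)⟩ = 1` (it is
unique, as `B` is connected). -/
noncomputable def phi0 (B : SmoothDomain) : HMinus B :=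
  open Classical in
  if h : ∃ u : HMinus B, Kstar B u = (1 / 2 : ℂ) • u ∧ mean B u = 1 then h.choose else 0

/-- The projection onto `H₀^* = {u | ⟨u, χ(∂B)⟩ = 0}` along `φ₀`. As `⟨u, φ₀⟩_{H^*} = ⟨u, χ(∂B)⟩`,
it is the orthogonal projection for the inner product `innerH` below. -/
noncomputable def proj0 (B : SmoothDomain) : HMinus B →L[ℂ] HMinus B :=
  ContinuousLinearMap.id ℂ (HMinus B) - (mean B).smulRight (phi0 B)

/-- The operator `\tilde S_B`: it equals `S_B` on `H₀^*` and maps `φ₀` to `-χ(∂B)`. -/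
noncomputable def Stilde (B : SmoothDomain) : HMinus B →L[ℂ] HPlus B :=
  (S B).comp (proj0 B) - (mean B).smulRight (one B)

/-- The inner product `⟨u, v⟩_{H^*} = -⟨u, \tilde S_B v⟩_{-1/2,1/2}` on `H^{-1/2}(∂B)`. -/
noncomputable def innerH (B : SmoothDomain) (u v : HMinus B) : ℂ := -(u (Stilde B v))

/-- `(λ_j, φ_j)_{j ≥ 0}` are the eigenvalues and the normalised eigenfunctions of `K_B^*`: an
orthonormal basis of `H^*(∂B)` which starts with `φ₀`, for the eigenvalue `λ₀ = 1/2`. -/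
structure IsSpectralBasis (B : SmoothDomain) (lam : ℕ → ℝ) (φ : ℕ → HMinus B) : Prop where
  lam_zero : lam 0 = 1 / 2
  phi_zero : φ 0 = phi0 B
  eigen : ∀ j, Kstar B (φ j) = (lam j : ℂ) • φ j
  orthonormal : ∀ i j, innerH B (φ i) (φ j) = if i = j then 1 else 0
  expansion : ∀ u, HasSum (fun j => innerH B u (φ j) • φ j) u

/-! ### Resonances -/

/-- The Drude permittivity `ε_c(w) = ε₀ (1 - ω_p² / (w² + i w T⁻¹))`. -/
noncomputable def drude (ε₀ ωp T : ℝ) (w : ℂ) : ℂ :=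
  ε₀ * (1 - ωp ^ 2 / (w ^ 2 + Complex.I * w * (T : ℂ)⁻¹))

/-- The contrast `λ = (ε_m + ε_c) / (2 (ε_m - ε_c))`. -/
noncomputable def contrast (εm εc : ℂ) : ℂ := (εm + εc) / (2 * (εm - εc))

/-- `τ_j = (1/ε_c - 1/ε_m) (λ - λ_j)`. -/
noncomputable def tau (εm εc : ℂ) (lamj : ℝ) : ℂ := (1 / εc - 1 / εm) * (contrast εm εc - lamj)

/-- The operator `(I/2 - K_B^*) \tilde S_B⁻¹ S_{B,1}^{(1)}`. -/
noncomputable def alphaOp (B : SmoothDomain) : HMinus B →L[ℂ] HMinus B :=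
  ((1 / 2 : ℂ) • ContinuousLinearMap.id ℂ (HMinus B) - Kstar B).comp
    ((Stilde B).inverse.comp (S11 B))

/-- The operator `A_{B,1} = ε_m⁻¹ K_{B,1}^{(1)} (I - P)
+ (I/2 - K_B^*) \tilde S_B⁻¹ S_{B,1}^{(1)} (ε_c⁻¹ I - ε_m⁻¹ P)`, with `P` the projection on
`H₀^*`. -/
noncomputable def A1 (B : SmoothDomain) (εm εc : ℂ) : HMinus B →L[ℂ] HMinus B :=
  (1 / εm) • (K11 B).comp (ContinuousLinearMap.id ℂ (HMinus B) - proj0 B) +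
    (alphaOp B).comp
      ((1 / εc) • ContinuousLinearMap.id ℂ (HMinus B) - (1 / εm) • proj0 B)

/-- `τ_{j,1} = ⟨A_{B,1} φ_j, φ_j⟩_{H^*}`. -/
noncomputable def tau1 (B : SmoothDomain) (εm εc : ℂ) (φj : HMinus B) : ℂ :=
  innerH B (A1 B εm εc φj) φj

/-- `α_j = ⟨(I/2 - K_B^*) \tilde S_B⁻¹ S_{B,1}^{(1)} φ_j, φ_j⟩_{H^*}`. -/
noncomputable def alpha (B : SmoothDomain) (φj : HMinus B) : ℂ := innerH B (alphaOp B φj) φj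

/-- The speed of light `(ε μ)^{-1/2}`. -/
noncomputable def speed (ε μ : ℝ) : ℝ := 1 / Real.sqrt (ε * μ)

/-- The frequencies at which `ε_c(w)` and `1/ε_c(w)`, hence `τ_j` and `τ_{j,1}`, are defined. -/
def DrudeRegular (ε₀ ωp T : ℝ) (w : ℂ) : Prop :=
  w ^ 2 + Complex.I * w * (T : ℂ)⁻¹ ≠ 0 ∧ drude ε₀ ωp T w ≠ 0

/-- `w` is a two-dimensional first-order corrected plasmonic resonance for the mode `(λ_j, φ_j)`
of a Drude particle of size `δ` and shape `B` in a medium with permittivity `ε_m` and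
permeability `μ_m`. -/
def IsFirstOrderResonance (B : SmoothDomain) (ε₀ ωp T εm μm δ : ℝ) (lamj : ℝ) (φj : HMinus B)
    (w : ℂ) : Prop :=
  DrudeRegular ε₀ ωp T w ∧
    ‖tau εm (drude ε₀ ωp T w) lamj + (w * δ * (speed εm μm : ℂ)⁻¹) ^ 2 *
      Complex.log (w * δ * (speed εm μm : ℂ)⁻¹) * tau1 B εm (drude ε₀ ωp T w) φj‖ = 0

end Plasmon

namespace Plasmon

/-! For `j ≥ 1` the whole resonance condition carries one common scalar factor, `1/ε_c - 1/ε_m`, and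
this factor never vanishes in vacuum. Pairing with `φ₀` in `H^*` gives the mean, so orthonormality
puts `φ_j` in `H₀^*` (`IsSpectralBasis.mean_eq_zero`) and `P φ_j = φ_j`. The term with `I - P` then
drops out of `A_{B,1} φ_j`, and the other term becomes `1/ε_c - 1/ε_m` times the operator that
defines `α_j`. Thus `τ_{j,1} = (1/ε_c - 1/ε_m) α_j` (`tau1_of_mean_eq_zero`), while `τ_j` has this
factor by definition. Since `ε_c ≠ ε₀` at every admissible frequency (`one_div_drude_sub_ne_zero`),
the factor can be cancelled. What remains is the stated equation once `λ` is written in terms of `Ω`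
(`contrast_drude`). -/

theorem innerH_smul_left (B : SmoothDomain) (a : ℂ) (u v : HMinus B) :
    innerH B (a • u) v = a * innerH B u v := by
  simp [innerH]

/-- As soon as `φ₀` is not the junk value `0`, it has mean one. -/
theorem mean_phi0 {B : SmoothDomain} (h : phi0 B ≠ 0) : mean B (phi0 B) = 1 := by
  classical
  unfold phi0 at h ⊢
  split_ifs at h ⊢ with hex
  · exact hex.choose_spec.2
  · exact absurd rfl h

theorem proj0_phi0 {B : SmoothDomain} (h : mean B (phi0 B) = 1) : proj0 B (phi0 B) = 0 := by
  simp [proj0, h]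

/-- The projection kills `φ₀`, so the part through `S_B` vanishes and only the rank-one correction
is left. -/
theorem Stilde_phi0 {B : SmoothDomain} (h : mean B (phi0 B) = 1) :
    Stilde B (phi0 B) = -one B := by
  simp [Stilde, proj0_phi0 h, h]

/-- `⟨u, φ₀⟩_{H^*} = ⟨u, χ(∂B)⟩`. -/
theorem innerH_phi0 {B : SmoothDomain} (h : mean B (phi0 B) = 1) (u : HMinus B) :
    innerH B u (phi0 B) = mean B u := by
  -- The sign in the definition of the inner product cancels the one in `-χ`.
  rw [innerH, Stilde_phi0 h, map_neg, neg_neg]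
  rfl

theorem proj0_of_mean_eq_zero {B : SmoothDomain} {u : HMinus B} (h : mean B u = 0) :
    proj0 B u = u := by
  simp [proj0, h]

/-! ### Modes `j ≥ 1` have mean zero -/

namespace IsSpectralBasis

variable {B : SmoothDomain} {lam : ℕ → ℝ} {φ : ℕ → HMinus B}

/-- The normalisation `⟨φ₀, φ₀⟩ = 1` rules out the default value `0` of `phi0`. -/
theorem mean_phi0_eq_one (hφ : IsSpectralBasis B lam φ) : mean B (phi0 B) = 1 := by
  refine mean_phi0 fun h => ?_
  have h1 := hφ.orthonormal 0 0
  simp [hφ.phi_zero, h, innerH] at h1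

/-- The mean of `φ_j` is its `H^*` product with `φ₀`, which is the basis element of index `0`. -/
theorem mean_eq_zero (hφ : IsSpectralBasis B lam φ) {j : ℕ} (hj : 1 ≤ j) :
    mean B (φ j) = 0 := by
  rw [← innerH_phi0 hφ.mean_phi0_eq_one, ← hφ.phi_zero, hφ.orthonormal,
    if_neg (Nat.one_le_iff_ne_zero.1 hj)]

end IsSpectralBasis

/-- On a fixed vector of `P`, `I - P` gives `0` and `b I - a P` acts as the scalar `b - a`. Only
linearity matters, so the operators are left abstract. -/
theorem corrector_apply_of_fixed {E : Type*} [AddCommGroup E] [Module ℂ E]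
    [TopologicalSpace E] [IsTopologicalAddGroup E] [ContinuousConstSMul ℂ E]
    (K A P : E →L[ℂ] E) (a b : ℂ) {u : E} (h : P u = u) :
    (a • K.comp (ContinuousLinearMap.id ℂ E - P) +
      A.comp (b • ContinuousLinearMap.id ℂ E - a • P)) u = (b - a) • A u := by
  simp [h, sub_smul]

/-- The scalar that comes out is exactly the prefactor in `tau`; this is what makes the cancellation
in the main theorem possible. -/
theorem tau1_of_mean_eq_zero {B : SmoothDomain} (εm εc : ℂ) {u : HMinus B} (h : mean B u = 0) :
    tau1 B εm εc u = (1 / εc - 1 / εm) * alpha B u := by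
  have hA : A1 B εm εc u = (1 / εc - 1 / εm) • alphaOp B u := by
    rw [A1]
    exact corrector_apply_of_fixed (K11 B) (alphaOp B) (proj0 B) (1 / εm) (1 / εc)
      (proj0_of_mean_eq_zero h)
  rw [tau1, hA, innerH_smul_left, alpha]

/-! ### The Drude law in vacuum -/

section Drude

variable {ε₀ ωp T : ℝ} {w : ℂ}

/-- In vacuum the permittivity of a Drude particle differs from that of the medium. -/
theorem one_div_drude_sub_ne_zero (hε₀ : ε₀ ≠ 0) (hωp : ωp ≠ 0) (hw : DrudeRegular ε₀ ωp T w) :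
    1 / drude ε₀ ωp T w - 1 / (ε₀ : ℂ) ≠ 0 := by
  have hε : (ε₀ : ℂ) ≠ 0 := Complex.ofReal_ne_zero.2 hε₀
  have hω : (ωp : ℂ) ≠ 0 := Complex.ofReal_ne_zero.2 hωp
  intro h
  have h1 : drude ε₀ ωp T w = ε₀ := by simpa using sub_eq_zero.1 h
  have h2 : 1 - (ωp : ℂ) ^ 2 / (w ^ 2 + Complex.I * w * (T : ℂ)⁻¹) = 1 :=
    mul_left_cancel₀ hε (by rw [mul_one]; exact h1)
  -- Equal permittivities would force `ωp² / (w² + i w T⁻¹) = 0`, a quotient of nonzero numbers.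
  exact div_ne_zero (pow_ne_zero 2 hω) hw.1 (by simpa using h2)

/-- With `D = w² + i w T⁻¹`, the difference of the permittivities is `ε₀ ωp² / D` and their sum is
`ε₀ (2 - ωp² / D)`; half the quotient of sum by difference is `D / ωp² - 1/2`. -/
theorem contrast_drude (hε₀ : ε₀ ≠ 0) (hωp : ωp ≠ 0)
    (hw : w ^ 2 + Complex.I * w * (T : ℂ)⁻¹ ≠ 0) :
    contrast ε₀ (drude ε₀ ωp T w) =
      (w ^ 2 + Complex.I * w * (T : ℂ)⁻¹) / (ωp : ℂ) ^ 2 - 1 / 2 := by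
  have hε : (ε₀ : ℂ) ≠ 0 := Complex.ofReal_ne_zero.2 hε₀
  have hω : (ωp : ℂ) ≠ 0 := Complex.ofReal_ne_zero.2 hωp
  rw [contrast, drude]
  generalize w ^ 2 + Complex.I * w * (T : ℂ)⁻¹ = D at hw ⊢
  have hd : (ε₀ : ℂ) - ε₀ * (1 - (ωp : ℂ) ^ 2 / D) = ε₀ * (ωp : ℂ) ^ 2 / D := by ring
  rw [hd]
  field_simp
  ring

end Drude

end Plasmon

theorem mainTheorem7 (B : Plasmon.SmoothDomain) (ε₀ μ₀ ωp T δ : ℝ)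
    (hε₀ : 0 < ε₀) (hμ₀ : 0 < μ₀) (hωp : 0 < ωp) (hT : 0 < T) (hδ : 0 < δ)
    (lam : ℕ → ℝ) (φ : ℕ → Plasmon.HMinus B) (hφ : Plasmon.IsSpectralBasis B lam φ)
    (j : ℕ) (hj : 1 ≤ j) :
    {Ω : ℂ | Plasmon.IsFirstOrderResonance B ε₀ ωp T ε₀ μ₀ δ (lam j) (φ j) Ω} =
      {Ω : ℂ | Plasmon.DrudeRegular ε₀ ωp T Ω ∧
        (Ω ^ 2 + Complex.I * Ω * (T : ℂ)⁻¹) / (ωp : ℂ) ^ 2 - 1 / 2 - (lam j : ℂ) +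
          (Ω * δ * (Plasmon.speed ε₀ μ₀ : ℂ)⁻¹) ^ 2 *
            Complex.log (Ω * δ * (Plasmon.speed ε₀ μ₀ : ℂ)⁻¹) * Plasmon.alpha B (φ j) = 0} := by
  ext Ω
  -- Admissibility is required on both sides, so only the two equations need comparing, at an
  -- admissible `Ω`.
  refine and_congr_right fun hΩ => ?_
  -- The factor `1/ε_c - 1/ε₀` is moved to the front of the second term, pulled out of the sum and
  -- discarded as nonzero.
  rw [norm_eq_zero, Plasmon.tau1_of_mean_eq_zero _ _ (hφ.mean_eq_zero hj), Plasmon.tau,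
    mul_left_comm, ← mul_add, mul_eq_zero,
    or_iff_right (Plasmon.one_div_drude_sub_ne_zero hε₀.ne' hωp.ne' hΩ),
    Plasmon.contrast_drude hε₀.ne' hωp.ne' hΩ.1]
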